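/- Consider correlations $P(a,b,c|x,z)$ with $a,c\in\{-1,1\}$, $b=b_1b_2\in\{00,01,10,11\}$, $x\in\{1,2,3\}$, $z\in\{1,\dots,6\}$. Say that $P$ has a *real quantum representation* if there are real Hilbert spaces $H_A,H_{B_1},H_{B_2},H_C$ of arbitrary (possibly infinite) dimension, a discrete probability distribution $P(\lambda)$, density operators $\tilde\sigma^\lambda_{AB_1}$ on $H_A\otimes H_{B_1}$ and $\tilde\sigma^\lambda_{B_2C}$ on $H_{B_2}\otimes H_C$ (positive semidefinite, trace one), and projective measurements $\{\tilde A_{a|x}\}_a$ on $H_A$, $\{\tilde B_b\}_b$ on $H_{B_1}\otimes H_{B_2}$ and $\{\tilde C_{c|z}\}_c$ on $H_C$ (orthogonal projections with $\sum_a\tilde A_{a|x}=\mathbb I$ for every $x$, $\sum_b\tilde B_b=\mathbb I$, $\sum_c\tilde C_{c|z}=\mathbb I$ for every $z$) such that for all $a,b,c,x,z$ $$P(a,b,c|x,z)=\sum_\lambda P(\lambda)\,\mathrm{tr}\left\{(\tilde\sigma^\lambda_{AB_1}\otimes\tilde\sigma^\lambda_{B_2C})(\tilde A_{a|x}\otimes\tilde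 B_b\otimes\tilde C_{c|z})\right\}.$$ Let $\bar P$ be the correlation $$\bar P(a,b,c|x,z)=\mathrm{tr}\left\{(\Phi^+_{AB_1}\otimes\Phi^+_{B_2C})(\bar A_{a|x}\otimes\bar B_b\otimes\bar C_{c|z})\right\}$$ of complex qubits $A,B_1,B_2,C$. Here $\Phi^+=|\phi^+\rangle\langle\phi^+|$. The operators $\bar B_b$ for $b=00,01,10,11$ are the orthogonal projections onto $\phi^+,\psi^+,\phi^-,\psi^-$, where $|\phi^\pm\rangle=\frac{1}{\sqrt2}(|00\rangle\pm|11\rangle)$ and $|\psi^\pm\rangle=\frac1{\sqrt2}(|10\rangle\pm|01\rangle)$. The operators $\bar A_{\pm1|x}$ are the spectral projections for the eigenvalues $\pm1$ of the Pauli matrices $\sigma_Z,\sigma_X,\sigma_Y$ for $x=1,2,3$. The operators $\bar C_{\pm1|z}$ are the spectral projections for the eigenvalues $\pm1$ of $D_{zx},E_{zx},D_{zy},E_{zy},D_{xy},E_{xy}$ for $z=1,\dots,6$, where $D_{ij}=(\sigma_i+\sigma_j)/\sqrt2$ and $E_{ij}=(\sigma_i-\sigma_j)/\sqrt2$. Then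 $\bar P$ has no real quantum representation. -/

import Mathlib

open scoped TensorProduct Matrix Kronecker

noncomputable section

namespace RealQuantum

/-! ### Hilbert space tensor products -/

section Hilbert

variable (𝕜 : Type*) [RCLike 𝕜]

/-- The Hilbert space tensor product `H ⊗ K`: the completion of the algebraic tensor product for
the inner product determined by `⟪h ⊗ k, h' ⊗ k'⟫ = ⟪h, h'⟫ * ⟪k, k'⟫`. -/
def HTensor (H K : Type*) [NormedAddCommGroup H] [InnerProductSpace 𝕜 H]
    [NormedAddCommGroup K] [InnerProductSpace 𝕜 K] : Type _ :=
  UniformSpace.Completion (H ⊗[𝕜] K)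

variable {H K H' K' : Type*}
  [NormedAddCommGroup H] [InnerProductSpace 𝕜 H]
  [NormedAddCommGroup K] [InnerProductSpace 𝕜 K]
  [NormedAddCommGroup H'] [InnerProductSpace 𝕜 H']
  [NormedAddCommGroup K'] [InnerProductSpace 𝕜 K']

instance : NormedAddCommGroup (HTensor 𝕜 H K) :=
  inferInstanceAs (NormedAddCommGroup (UniformSpace.Completion (H ⊗[𝕜] K)))

instance : InnerProductSpace 𝕜 (HTensor 𝕜 H K) :=
  inferInstanceAs (InnerProductSpace 𝕜 (UniformSpace.Completion (H ⊗[𝕜] K)))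

instance : CompleteSpace (HTensor 𝕜 H K) :=
  inferInstanceAs (CompleteSpace (UniformSpace.Completion (H ⊗[𝕜] K)))

variable {𝕜} in
/-- The tensor product `S ⊗ T` of two bounded operators, acting on the Hilbert space tensor
product. -/
def opTensor (S : H →L[𝕜] H) (T : K →L[𝕜] K) : HTensor 𝕜 H K →L[𝕜] HTensor 𝕜 H K :=
  (TensorProduct.mapL S T).completion

variable (H K) in
/-- The inclusion of the algebraic tensor product in the Hilbert space tensor product. -/
def inclHTensor : (H ⊗[𝕜] K) →ₗᵢ[𝕜] HTensor 𝕜 H K :=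
  UniformSpace.Completion.toComplₗᵢ

theorem denseRange_inclHTensor : DenseRange (inclHTensor 𝕜 H K) :=
  UniformSpace.Completion.denseRange_coe

variable {𝕜} in
theorem denseRange_mapIsometry (f : H →ₗᵢ[𝕜] H') (g : K →ₗᵢ[𝕜] K')
    (hf : DenseRange f) (hg : DenseRange g) :
    DenseRange (TensorProduct.mapIsometry f g) := by
  set S : Submodule 𝕜 (H' ⊗[𝕜] K') :=
    (LinearMap.range (TensorProduct.mapIsometry f g).toLinearMap).topologicalClosure with hS
  have hpure : ∀ (x : H') (y : K'), x ⊗ₜ[𝕜] y ∈ S := by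
    intro x y
    have hd : DenseRange (Prod.map f g) := hf.prodMap hg
    have hc : IsClosed {q : H' × K' | q.1 ⊗ₜ[𝕜] q.2 ∈ S} :=
      (Submodule.isClosed_topologicalClosure _).preimage TensorProduct.continuous_tmul
    refine hd.induction_on (p := fun q : H' × K' => q.1 ⊗ₜ[𝕜] q.2 ∈ S) (x, y) hc ?_
    intro q
    exact Submodule.le_topologicalClosure _ ⟨q.1 ⊗ₜ[𝕜] q.2, by simp⟩
  have hall : ∀ t : H' ⊗[𝕜] K', t ∈ S := by
    intro t
    induction t using TensorProduct.induction_on with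
    | zero => exact S.zero_mem
    | tmul x y => exact hpure x y
    | add x y hx hy => exact S.add_mem hx hy
  intro t
  exact hall t

end Hilbert

section Reorder

variable (𝕜 : Type*) [RCLike 𝕜]
  (HA HB₁ HB₂ HC : Type*)
  [NormedAddCommGroup HA] [InnerProductSpace 𝕜 HA]
  [NormedAddCommGroup HB₁] [InnerProductSpace 𝕜 HB₁]
  [NormedAddCommGroup HB₂] [InnerProductSpace 𝕜 HB₂]
  [NormedAddCommGroup HC] [InnerProductSpace 𝕜 HC]

/-- The dense isometric inclusion of the algebraic tensor product `(A ⊗ B₁) ⊗ (B₂ ⊗ C)` in the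
corresponding Hilbert space. -/
def inclSources : (HA ⊗[𝕜] HB₁) ⊗[𝕜] (HB₂ ⊗[𝕜] HC) →ₗᵢ[𝕜]
    HTensor 𝕜 (HTensor 𝕜 HA HB₁) (HTensor 𝕜 HB₂ HC) :=
  (inclHTensor 𝕜 _ _).comp
    (TensorProduct.mapIsometry (inclHTensor 𝕜 HA HB₁) (inclHTensor 𝕜 HB₂ HC))

/-- The dense isometric inclusion of the algebraic tensor product `A ⊗ ((B₁ ⊗ B₂) ⊗ C)` in the
corresponding Hilbert space. -/
def inclParties : HA ⊗[𝕜] ((HB₁ ⊗[𝕜] HB₂) ⊗[𝕜] HC) →ₗᵢ[𝕜]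
    HTensor 𝕜 HA (HTensor 𝕜 (HTensor 𝕜 HB₁ HB₂) HC) :=
  (inclHTensor 𝕜 _ _).comp
    (TensorProduct.mapIsometry LinearIsometry.id ((inclHTensor 𝕜 _ _).comp
      (TensorProduct.mapIsometry (inclHTensor 𝕜 HB₁ HB₂) LinearIsometry.id)))

theorem denseRange_inclSources : DenseRange (inclSources 𝕜 HA HB₁ HB₂ HC) :=
  (denseRange_inclHTensor 𝕜).comp
    (denseRange_mapIsometry _ _ (denseRange_inclHTensor 𝕜) (denseRange_inclHTensor 𝕜))
    (inclHTensor 𝕜 _ _).continuous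

theorem denseRange_inclParties : DenseRange (inclParties 𝕜 HA HB₁ HB₂ HC) :=
  (denseRange_inclHTensor 𝕜).comp
    (denseRange_mapIsometry _ _ Function.surjective_id.denseRange
      ((denseRange_inclHTensor 𝕜).comp
        (denseRange_mapIsometry _ _ (denseRange_inclHTensor 𝕜) Function.surjective_id.denseRange)
        (inclHTensor 𝕜 _ _).continuous))
    (inclHTensor 𝕜 _ _).continuous

/-- The algebraic rebracketing `(a ⊗ b₁) ⊗ (b₂ ⊗ c) ↦ a ⊗ ((b₁ ⊗ b₂) ⊗ c)`. -/
def algRebracket : (HA ⊗[𝕜] HB₁) ⊗[𝕜] (HB₂ ⊗[𝕜] HC) ≃ₗᵢ[𝕜]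
    HA ⊗[𝕜] ((HB₁ ⊗[𝕜] HB₂) ⊗[𝕜] HC) :=
  (TensorProduct.assocIsometry 𝕜 HA HB₁ (HB₂ ⊗[𝕜] HC)).trans
    ((TensorProduct.assocIsometry 𝕜 HB₁ HB₂ HC).symm.lTensor HA)

theorem algRebracket_tmul (a : HA) (b₁ : HB₁) (b₂ : HB₂) (c : HC) :
    algRebracket 𝕜 HA HB₁ HB₂ HC ((a ⊗ₜ b₁) ⊗ₜ (b₂ ⊗ₜ c)) = a ⊗ₜ ((b₁ ⊗ₜ b₂) ⊗ₜ c) := by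
  simp [algRebracket]

/-- The unitary identification `(A ⊗ B₁) ⊗ (B₂ ⊗ C) ≃ A ⊗ ((B₁ ⊗ B₂) ⊗ C)` of Hilbert spaces:
the grouping of the systems by source is turned into the grouping by party. -/
def regroup : HTensor 𝕜 (HTensor 𝕜 HA HB₁) (HTensor 𝕜 HB₂ HC) ≃ₗᵢ[𝕜]
    HTensor 𝕜 HA (HTensor 𝕜 (HTensor 𝕜 HB₁ HB₂) HC) :=
  (algRebracket 𝕜 HA HB₁ HB₂ HC).toLinearEquiv.extendOfIsometry
    (inclSources 𝕜 HA HB₁ HB₂ HC).toLinearMap (inclParties 𝕜 HA HB₁ HB₂ HC).toLinearMap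
    (denseRange_inclSources 𝕜 HA HB₁ HB₂ HC) (denseRange_inclParties 𝕜 HA HB₁ HB₂ HC)
    (fun x => by
      exact ((inclParties 𝕜 HA HB₁ HB₂ HC).norm_map _).trans
        (((algRebracket 𝕜 HA HB₁ HB₂ HC).norm_map x).trans
          ((inclSources 𝕜 HA HB₁ HB₂ HC).norm_map x).symm))

variable {𝕜 HA HB₁ HB₂ HC} in
/-- The joint operator `A ⊗ B ⊗ C` of the three parties, where `B` acts on `B₁ ⊗ B₂`, as an
operator on the space `(A ⊗ B₁) ⊗ (B₂ ⊗ C)` of the two sources. -/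
def partiesOp (A : HA →L[𝕜] HA) (B : HTensor 𝕜 HB₁ HB₂ →L[𝕜] HTensor 𝕜 HB₁ HB₂) (C : HC →L[𝕜] HC) :
    HTensor 𝕜 (HTensor 𝕜 HA HB₁) (HTensor 𝕜 HB₂ HC) →L[𝕜]
      HTensor 𝕜 (HTensor 𝕜 HA HB₁) (HTensor 𝕜 HB₂ HC) :=
  ((regroup 𝕜 HA HB₁ HB₂ HC).symm : _ →L[𝕜] _) ∘L opTensor A (opTensor B C) ∘L
    (regroup 𝕜 HA HB₁ HB₂ HC : _ →L[𝕜] _)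

end Reorder

/-! ### States, measurements and the trace -/

section Quantum

variable {𝕜 : Type*} [RCLike 𝕜]
  {H : Type*} [NormedAddCommGroup H] [InnerProductSpace 𝕜 H]

/-- `tr T = t`: in every Hilbert basis `e`, the series `∑ i, ⟪e i, T (e i)⟫` converges
(unconditionally) to `t`. -/
def HasTrace (T : H →L[𝕜] H) (t : 𝕜) : Prop :=
  ∀ (s : Set H) (e : HilbertBasis s 𝕜 H), HasSum (fun i : s => inner 𝕜 (e i) (T (e i))) t

/-- A quantum state (density operator): a positive semidefinite (in particular self-adjoint)
operator of trace one. -/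
def IsState (ρ : H →L[𝕜] H) : Prop :=
  ρ.IsPositive ∧ HasTrace ρ 1

/-- A projective measurement with finitely many outcomes: orthogonal projections that sum to the
identity. -/
def IsProjectiveMeasurement [CompleteSpace H] {R : Type*} [Fintype R]
    (M : R → (H →L[𝕜] H)) : Prop :=
  (∀ r, IsStarProjection (M r)) ∧ ∑ r, M r = 1

end Quantum

/-! ### Correlations in the entanglement-swapping network -/

/-- A correlation `P a b c x z = P(a,b,c|x,z)`: Alice has settings `x = 0, 1, 2` and outcomes
`a = ±1`, Bob has outcomes `b = (b₁, b₂)`, Charlie has settings `z = 0, …, 5` and outcomes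
`c = ±1`. -/
abbrev Correlation : Type :=
  ℤˣ → Fin 2 × Fin 2 → ℤˣ → Fin 3 → Fin 6 → ℝ

/-- The correlation `P` has a quantum representation on the Hilbert spaces `HA, HB₁, HB₂, HC` over
`𝕜`, with shared randomness in `Λ`:
`P(a,b,c|x,z) = ∑ l, p l * tr ((σL l ⊗ σR l) (A x a ⊗ B b ⊗ C z c))`
for a probability distribution `p` on `Λ`, states `σL l` of `A ⊗ B₁` and `σR l` of `B₂ ⊗ C`, and
projective measurements `A x`, `B`, `C z` on `A`, `B₁ ⊗ B₂`, `C`. -/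
def HasSwapDecomposition (𝕜 : Type*) [RCLike 𝕜] (HA HB₁ HB₂ HC Λ : Type*)
    [NormedAddCommGroup HA] [InnerProductSpace 𝕜 HA] [CompleteSpace HA]
    [NormedAddCommGroup HB₁] [InnerProductSpace 𝕜 HB₁] [CompleteSpace HB₁]
    [NormedAddCommGroup HB₂] [InnerProductSpace 𝕜 HB₂] [CompleteSpace HB₂]
    [NormedAddCommGroup HC] [InnerProductSpace 𝕜 HC] [CompleteSpace HC]
    (P : Correlation) : Prop :=
  ∃ (p : Λ → ℝ)
    (σL : Λ → (HTensor 𝕜 HA HB₁ →L[𝕜] HTensor 𝕜 HA HB₁))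
    (σR : Λ → (HTensor 𝕜 HB₂ HC →L[𝕜] HTensor 𝕜 HB₂ HC))
    (A : Fin 3 → ℤˣ → (HA →L[𝕜] HA))
    (B : Fin 2 × Fin 2 → (HTensor 𝕜 HB₁ HB₂ →L[𝕜] HTensor 𝕜 HB₁ HB₂))
    (C : Fin 6 → ℤˣ → (HC →L[𝕜] HC)),
    (∀ l, 0 ≤ p l) ∧ HasSum p 1 ∧
    (∀ l, IsState (σL l)) ∧ (∀ l, IsState (σR l)) ∧
    (∀ x, IsProjectiveMeasurement (A x)) ∧ IsProjectiveMeasurement B ∧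
    (∀ z, IsProjectiveMeasurement (C z)) ∧
    ∀ a b c x z, ∃ q : Λ → 𝕜,
      (∀ l, HasTrace (opTensor (σL l) (σR l) ∘L partiesOp (A x a) (B b) (C z c)) (q l)) ∧
      HasSum (fun l => (p l : 𝕜) * q l) (P a b c x z : 𝕜)

/-! ### The ideal correlation -/

/-- The Pauli matrix `σ_X`. -/
def pauliX : Matrix (Fin 2) (Fin 2) ℂ := !![0, 1; 1, 0]

/-- The Pauli matrix `σ_Y`. -/
def pauliY : Matrix (Fin 2) (Fin 2) ℂ := !![0, -Complex.I; Complex.I, 0]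

/-- The Pauli matrix `σ_Z`. -/
def pauliZ : Matrix (Fin 2) (Fin 2) ℂ := !![1, 0; 0, -1]

/-- `1 / √2`, as a complex number. -/
def invSqrtTwo : ℂ := ((1 / √2 : ℝ) : ℂ)

/-- Alice's three observables `σ_Z, σ_X, σ_Y`. -/
def aliceObservable : Fin 3 → Matrix (Fin 2) (Fin 2) ℂ :=
  ![pauliZ, pauliX, pauliY]

/-- Charlie's six observables `D_zx, E_zx, D_zy, E_zy, D_xy, E_xy`, where
`D_ij = (σ_i + σ_j) / √2` and `E_ij = (σ_i - σ_j) / √2`. -/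
def charlieObservable : Fin 6 → Matrix (Fin 2) (Fin 2) ℂ :=
  ![invSqrtTwo • (pauliZ + pauliX), invSqrtTwo • (pauliZ - pauliX),
    invSqrtTwo • (pauliZ + pauliY), invSqrtTwo • (pauliZ - pauliY),
    invSqrtTwo • (pauliX + pauliY), invSqrtTwo • (pauliX - pauliY)]

/-- The projections `(1 ± O) / 2` of the measurement with outcomes `±1` and observable `O`. -/
def outcomeProj (O : Matrix (Fin 2) (Fin 2) ℂ) (s : ℤˣ) : Matrix (Fin 2) (Fin 2) ℂ :=
  (1 / 2 : ℂ) • (1 + ((s : ℤ) : ℂ) • O)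

/-- The computational basis vector `|i j⟩` of two qubits. -/
def ket (i j : Fin 2) : Fin 2 × Fin 2 → ℂ := Pi.single (i, j) 1

/-- The Bell basis; the labels `00, 01, 10, 11` stand for `φ⁺, ψ⁺, φ⁻, ψ⁻`. -/
def bellVector : Fin 2 × Fin 2 → (Fin 2 × Fin 2 → ℂ)
  | (0, 0) => invSqrtTwo • (ket 0 0 + ket 1 1)
  | (0, 1) => invSqrtTwo • (ket 1 0 + ket 0 1)
  | (1, 0) => invSqrtTwo • (ket 0 0 - ket 1 1)
  | (1, 1) => invSqrtTwo • (ket 1 0 - ket 0 1)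

/-- The projection `|v⟩⟨v|` onto the Bell vector `v` with label `b`. -/
def bellProj (b : Fin 2 × Fin 2) : Matrix (Fin 2 × Fin 2) (Fin 2 × Fin 2) ℂ :=
  Matrix.vecMulVec (bellVector b) (star (bellVector b))

/-- Regrouping of the four qubits from `((A, B₁), (B₂, C))` to `(A, ((B₁, B₂), C))`. -/
def regroupIndex (i : (Fin 2 × Fin 2) × (Fin 2 × Fin 2)) : Fin 2 × ((Fin 2 × Fin 2) × Fin 2) :=
  (i.1.1, ((i.1.2, i.2.1), i.2.2))

/-- The correlation of the ideal entanglement-swapping experiment,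
`tr ((Φ⁺ ⊗ Φ⁺) (A x a ⊗ B b ⊗ C z c))`, with two sources that emit `Φ⁺`, a Bell measurement by
Bob, and the above observables of Alice and Charlie. -/
def idealCorrelation : Correlation := fun a b c x z =>
  (Matrix.trace
    ((bellProj (0, 0) ⊗ₖ bellProj (0, 0)) *
      (outcomeProj (aliceObservable x) a ⊗ₖ
        (bellProj b ⊗ₖ outcomeProj (charlieObservable z) c)).submatrix
          regroupIndex regroupIndex)).re

end RealQuantum

end

/-! The obstruction is the product `σ_Z σ_X σ_Y = i`: its antisymmetric part can have a nonzero
expectation over the complex numbers but never over the reals.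

For each outcome `b` of Bob, three CHSH tests reach the Tsirelson bound in the ideal correlation
(`chshGap_idealCorrelation`). Each gap is nonnegative on pure states (`chshGap_vectorCorrelation`).
States with a trace have eigenbases, so a real representation is a mixture of pure product states,
and one product state `u = ψ ⊗ χ` closes all the gaps at once (`exists_pure_product`).

On `w = β b u`, a closed gap says that Alice's observable `a x` acts as `s x` times an observable `k
x` of Charlie, with Bell signs `s x` (`observable_apply_of_chshGap_eq_zero`). Charlie's sum and
difference anticommute within each test, hence Alice's observables anticommute on `w`, and
reordering gives `T w = S w` for the triple commutators `T` of Alice and `S` of Charlie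
(`triple_product_of_correlated`). The sign in this identity is `s 0 * s 1 * s 2 = -1` for every `b`,
so summing over `b` gives `T u = S u`.

Independence of the sources factors `⟪u, T S u⟫` into an expectation in `ψ` times one in `χ`; the
first vanishes because `T` is antisymmetric over `ℝ` (`inner_outer_eq_zero`). But `⟪u, T S u⟫ = ⟪u,
T T u⟫ = -‖T u‖²`, while anticommutation makes `T u` twice `a 0 (a 1 (a 2 u))`, of norm `2‖u‖`. So
`u = 0`, which contradicts `‖u‖ = 1` (`eq_zero_of_chshGap_eq_zero`). -/

noncomputable section

namespace RealQuantum

/-! ### Pure tensors, product bases and local operators on Hilbert tensor products -/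

section TensorOperators

variable {𝕜 : Type*} [RCLike 𝕜] {H K : Type*}
  [NormedAddCommGroup H] [InnerProductSpace 𝕜 H]
  [NormedAddCommGroup K] [InnerProductSpace 𝕜 K]

/-- The pure tensor `x ⊗ y` in the Hilbert space tensor product. -/
def pureTensor (x : H) (y : K) : HTensor 𝕜 H K := inclHTensor 𝕜 H K (x ⊗ₜ y)

theorem inner_pureTensor (x x' : H) (y y' : K) :
    inner 𝕜 (pureTensor (𝕜 := 𝕜) x y) (pureTensor x' y') = inner 𝕜 x x' * inner 𝕜 y y' := by
  simp [pureTensor, LinearIsometry.inner_map_map]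

theorem norm_pureTensor (x : H) (y : K) : ‖pureTensor (𝕜 := 𝕜) x y‖ = ‖x‖ * ‖y‖ := by
  simp [pureTensor]

theorem opTensor_incl (S : H →L[𝕜] H) (T : K →L[𝕜] K) (t : H ⊗[𝕜] K) :
    opTensor S T (inclHTensor 𝕜 H K t) = inclHTensor 𝕜 H K (TensorProduct.mapL S T t) :=
  ContinuousLinearMap.completion_apply_coe _ _

theorem opTensor_pureTensor (S : H →L[𝕜] H) (T : K →L[𝕜] K) (x : H) (y : K) :
    opTensor S T (pureTensor x y) = pureTensor (S x) (T y) := by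
  simp [pureTensor, opTensor_incl]

/-- The pure tensors are total in the Hilbert space tensor product. -/
theorem eq_top_of_pureTensor_mem (S : Submodule 𝕜 (HTensor 𝕜 H K))
    (hS : IsClosed (S : Set (HTensor 𝕜 H K))) (h : ∀ x y, pureTensor x y ∈ S) : S = ⊤ := by
  refine Submodule.eq_top_iff'.2 fun z => ?_
  refine (denseRange_inclHTensor 𝕜 (H := H) (K := K)).induction_on
    (p := fun z => z ∈ S) z hS fun t => ?_
  induction t using TensorProduct.induction_on with
  | zero => simp
  | tmul x y => exact h x y
  | add x y hx hy => simpa using S.add_mem hx hy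

theorem ext_pureTensor {G : Type*} [NormedAddCommGroup G] [NormedSpace 𝕜 G]
    {S T : HTensor 𝕜 H K →L[𝕜] G}
    (h : ∀ x y, S (pureTensor x y) = T (pureTensor x y)) : S = T := by
  have := eq_top_of_pureTensor_mem (LinearMap.eqLocus S.toLinearMap T.toLinearMap)
    (isClosed_eq S.continuous T.continuous) h
  ext z
  exact (this ▸ Submodule.mem_top : z ∈ LinearMap.eqLocus S.toLinearMap T.toLinearMap)

theorem pureTensor_add_left (x x' : H) (y : K) :
    pureTensor (𝕜 := 𝕜) (x + x') y = pureTensor x y + pureTensor x' y := by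
  simp [pureTensor, TensorProduct.add_tmul]

theorem pureTensor_add_right (x : H) (y y' : K) :
    pureTensor (𝕜 := 𝕜) x (y + y') = pureTensor x y + pureTensor x y' := by
  simp [pureTensor, TensorProduct.tmul_add]

theorem pureTensor_smul_left (c : 𝕜) (x : H) (y : K) :
    pureTensor (𝕜 := 𝕜) (c • x) y = c • pureTensor x y := by
  simp [pureTensor, ← TensorProduct.smul_tmul']

theorem pureTensor_smul_right (c : 𝕜) (x : H) (y : K) :
    pureTensor (𝕜 := 𝕜) x (c • y) = c • pureTensor x y := by
  simp [pureTensor]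

variable (K) in
/-- The bounded map `y ↦ x ⊗ y`. -/
def tensorRight (x : H) : K →L[𝕜] HTensor 𝕜 H K :=
  (inclHTensor 𝕜 H K).toContinuousLinearMap ∘L TensorProduct.mkL 𝕜 H K x

variable (H) in
/-- The bounded map `x ↦ x ⊗ y`. -/
def tensorLeft (y : K) : H →L[𝕜] HTensor 𝕜 H K :=
  (inclHTensor 𝕜 H K).toContinuousLinearMap ∘L (TensorProduct.mkL 𝕜 H K).flip y

theorem opTensor_mul (S S' : H →L[𝕜] H) (T T' : K →L[𝕜] K) :
    opTensor (S * S') (T * T') = opTensor S T * opTensor S' T' :=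
  ext_pureTensor fun x y => by simp [opTensor_pureTensor]

theorem inner_opTensor_left [CompleteSpace H] [CompleteSpace K]
    (S : H →L[𝕜] H) (T : K →L[𝕜] K) (u v : HTensor 𝕜 H K) :
    inner 𝕜 (opTensor (star S) (star T) u) v = inner 𝕜 u (opTensor S T v) := by
  -- A bounded map is determined by pure tensors, so the adjoint relation is extended one slot at a
  -- time: first `v` with `u` pure, then `u` after conjugating.
  have key : ∀ x y, (innerSL 𝕜 (opTensor (star S) (star T) (pureTensor x y))) =
      (innerSL 𝕜 (pureTensor x y)) ∘L opTensor S T := fun x y =>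
    ext_pureTensor fun x' y' => by
      simp [opTensor_pureTensor, inner_pureTensor, ContinuousLinearMap.star_eq_adjoint,
        ContinuousLinearMap.adjoint_inner_left]
  have : (innerSL 𝕜 v) ∘L opTensor (star S) (star T) = innerSL 𝕜 (opTensor S T v) :=
    ext_pureTensor fun x y => by
      have := DFunLike.congr_fun (key x y) v
      simp only [ContinuousLinearMap.comp_apply, innerSL_apply_apply] at this ⊢
      rw [← inner_conj_symm, this, inner_conj_symm]
  have := DFunLike.congr_fun this u
  simp only [ContinuousLinearMap.comp_apply, innerSL_apply_apply] at this
  rw [← inner_conj_symm, this, inner_conj_symm]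

theorem HilbertBasis.clm_ext {ι : Type*} (e : HilbertBasis ι 𝕜 H)
    {G : Type*} [NormedAddCommGroup G] [NormedSpace 𝕜 G] {S T : H →L[𝕜] G}
    (h : ∀ i, S (e i) = T (e i)) : S = T :=
  ContinuousLinearMap.ext_on
    (Submodule.dense_iff_topologicalClosure_eq_top.2 e.dense_span) (by rintro _ ⟨i, rfl⟩; exact h i)

theorem orthonormal_pureTensor {ι κ : Type*} {e : ι → H} {f : κ → K} (he : Orthonormal 𝕜 e)
    (hf : Orthonormal 𝕜 f) :
    Orthonormal 𝕜 fun i : ι × κ => pureTensor (𝕜 := 𝕜) (e i.1) (f i.2) := by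
  classical
  rw [orthonormal_iff_ite] at *
  rintro ⟨i, j⟩ ⟨i', j'⟩
  rw [inner_pureTensor, he, hf]
  simp only [Prod.mk.injEq]
  split_ifs <;> simp_all

theorem eq_zero_of_inner_pureTensor_eq_zero {ι κ : Type*} (e : HilbertBasis ι 𝕜 H)
    (f : HilbertBasis κ 𝕜 K) {z : HTensor 𝕜 H K}
    (h : ∀ i j, inner 𝕜 z (pureTensor (e i) (f j)) = 0) : z = 0 := by
  have h₁ : ∀ i, innerSL 𝕜 z ∘L tensorRight K (e i) = 0 := fun i =>
    HilbertBasis.clm_ext f fun j => h i j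
  have h₂ : ∀ y, innerSL 𝕜 z ∘L tensorLeft H y = 0 := fun y =>
    HilbertBasis.clm_ext e fun i => DFunLike.congr_fun (h₁ i) y
  have h₃ : innerSL 𝕜 z = 0 := ext_pureTensor fun x y => DFunLike.congr_fun (h₂ y) x
  simpa using DFunLike.congr_fun h₃ z

/-- The tensor product of two Hilbert bases. -/
def hilbertBasisTensor {ι κ : Type*} (e : HilbertBasis ι 𝕜 H) (f : HilbertBasis κ 𝕜 K) :
    HilbertBasis (ι × κ) 𝕜 (HTensor 𝕜 H K) :=
  HilbertBasis.mkOfOrthogonalEqBot (orthonormal_pureTensor e.orthonormal f.orthonormal) <| by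
    rw [Submodule.eq_bot_iff]
    intro z hz
    refine eq_zero_of_inner_pureTensor_eq_zero e f fun i j => ?_
    exact (Submodule.mem_orthogonal' _ _).1 hz _ (Submodule.subset_span ⟨(i, j), rfl⟩)

theorem hilbertBasisTensor_apply {ι κ : Type*} (e : HilbertBasis ι 𝕜 H) (f : HilbertBasis κ 𝕜 K)
    (i : ι × κ) : hilbertBasisTensor e f i = pureTensor (e i.1) (f i.2) := by
  simp [hilbertBasisTensor]

variable [CompleteSpace H] [CompleteSpace K]

variable (𝕜 H K) in
/-- The representation `S ↦ S ⊗ 1` of the bounded operators of the first factor. -/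
def ampLeft : (H →L[𝕜] H) →⋆ₐ[𝕜] (HTensor 𝕜 H K →L[𝕜] HTensor 𝕜 H K) where
  toFun S := opTensor S 1
  map_one' := ext_pureTensor fun x y => by simp [opTensor_pureTensor]
  map_mul' S T := by simpa using opTensor_mul S T (1 : K →L[𝕜] K) 1
  map_zero' := ext_pureTensor fun x y => by
    simpa [opTensor_pureTensor] using pureTensor_smul_left (𝕜 := 𝕜) 0 x y
  map_add' S T := ext_pureTensor fun x y => by simp [opTensor_pureTensor, pureTensor_add_left]
  commutes' c := ext_pureTensor fun x y => by
    simp [opTensor_pureTensor, Algebra.algebraMap_eq_smul_one, pureTensor_smul_left]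
  map_star' S := by
    rw [ContinuousLinearMap.star_eq_adjoint (opTensor S 1), ContinuousLinearMap.eq_adjoint_iff]
    intro u v
    simpa using inner_opTensor_left S (1 : K →L[𝕜] K) u v

variable (𝕜 H K) in
/-- The representation `T ↦ 1 ⊗ T` of the bounded operators of the second factor. -/
def ampRight : (K →L[𝕜] K) →⋆ₐ[𝕜] (HTensor 𝕜 H K →L[𝕜] HTensor 𝕜 H K) where
  toFun T := opTensor 1 T
  map_one' := ext_pureTensor fun x y => by simp [opTensor_pureTensor]
  map_mul' S T := by simpa using opTensor_mul (1 : H →L[𝕜] H) 1 S T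
  map_zero' := ext_pureTensor fun x y => by
    simpa [opTensor_pureTensor] using pureTensor_smul_right (𝕜 := 𝕜) 0 x y
  map_add' S T := ext_pureTensor fun x y => by simp [opTensor_pureTensor, pureTensor_add_right]
  commutes' c := ext_pureTensor fun x y => by
    simp [opTensor_pureTensor, Algebra.algebraMap_eq_smul_one, pureTensor_smul_right]
  map_star' S := by
    rw [ContinuousLinearMap.star_eq_adjoint (opTensor 1 S), ContinuousLinearMap.eq_adjoint_iff]
    intro u v
    simpa using inner_opTensor_left (1 : H →L[𝕜] H) S u v

theorem ampLeft_apply (S : H →L[𝕜] H) : ampLeft 𝕜 H K S = opTensor S 1 := rfl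

theorem ampRight_apply (T : K →L[𝕜] K) : ampRight 𝕜 H K T = opTensor 1 T := rfl

theorem opTensor_eq_mul (S : H →L[𝕜] H) (T : K →L[𝕜] K) :
    opTensor S T = ampLeft 𝕜 H K S * ampRight 𝕜 H K T := by
  rw [ampLeft_apply, ampRight_apply, ← opTensor_mul, one_mul, mul_one]

theorem commute_ampLeft_ampRight (S : H →L[𝕜] H) (T : K →L[𝕜] K) :
    Commute (ampLeft 𝕜 H K S) (ampRight 𝕜 H K T) := by
  rw [Commute, SemiconjBy, ← opTensor_eq_mul, ampLeft_apply, ampRight_apply, ← opTensor_mul]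
  simp

end TensorOperators

/-! ### Grouping by source against grouping by party -/

section Parties

variable {𝕜 : Type*} [RCLike 𝕜] {HA HB₁ HB₂ HC : Type*}
  [NormedAddCommGroup HA] [InnerProductSpace 𝕜 HA]
  [NormedAddCommGroup HB₁] [InnerProductSpace 𝕜 HB₁]
  [NormedAddCommGroup HB₂] [InnerProductSpace 𝕜 HB₂]
  [NormedAddCommGroup HC] [InnerProductSpace 𝕜 HC]

theorem regroup_pureTensor (a : HA) (b₁ : HB₁) (b₂ : HB₂) (c : HC) :
    regroup 𝕜 HA HB₁ HB₂ HC (pureTensor (pureTensor a b₁) (pureTensor b₂ c)) =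
      pureTensor a (pureTensor (pureTensor b₁ b₂) c) := by
  have := LinearEquiv.extendOfIsometry_eq (algRebracket 𝕜 HA HB₁ HB₂ HC).toLinearEquiv
    (inclSources 𝕜 HA HB₁ HB₂ HC).toLinearMap (inclParties 𝕜 HA HB₁ HB₂ HC).toLinearMap
    (denseRange_inclSources 𝕜 HA HB₁ HB₂ HC) (denseRange_inclParties 𝕜 HA HB₁ HB₂ HC)
    (fun x => by
      exact ((inclParties 𝕜 HA HB₁ HB₂ HC).norm_map _).trans
        (((algRebracket 𝕜 HA HB₁ HB₂ HC).norm_map x).trans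
          ((inclSources 𝕜 HA HB₁ HB₂ HC).norm_map x).symm)) ((a ⊗ₜ b₁) ⊗ₜ (b₂ ⊗ₜ c))
  refine this.trans ?_
  simp [algRebracket_tmul, inclParties, pureTensor]

/-- Operators of the two outer parties act on the two sources separately. -/
theorem partiesOp_outer [CompleteSpace HA] [CompleteSpace HB₁] [CompleteSpace HB₂]
    [CompleteSpace HC] (S : HA →L[𝕜] HA) (T : HC →L[𝕜] HC) :
    partiesOp S (1 : HTensor 𝕜 HB₁ HB₂ →L[𝕜] HTensor 𝕜 HB₁ HB₂) T =
      opTensor (ampLeft 𝕜 HA HB₁ S) (ampRight 𝕜 HB₂ HC T) := by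
  set X := partiesOp S (1 : HTensor 𝕜 HB₁ HB₂ →L[𝕜] HTensor 𝕜 HB₁ HB₂) T with hX
  set Y := opTensor (ampLeft 𝕜 HA HB₁ S) (ampRight 𝕜 HB₂ HC T) with hY
  have h₁ : ∀ a b₁ b₂ c, X (pureTensor (pureTensor a b₁) (pureTensor b₂ c)) =
      Y (pureTensor (pureTensor a b₁) (pureTensor b₂ c)) := by
    intro a b₁ b₂ c
    have e : X (pureTensor (pureTensor a b₁) (pureTensor b₂ c)) =
      (regroup 𝕜 HA HB₁ HB₂ HC).symm (opTensor S (opTensor 1 T)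
        (regroup 𝕜 HA HB₁ HB₂ HC (pureTensor (pureTensor a b₁) (pureTensor b₂ c)))) := rfl
    rw [e, regroup_pureTensor, LinearIsometryEquiv.symm_apply_eq]
    simp [hY, opTensor_pureTensor, ampLeft_apply, ampRight_apply, regroup_pureTensor]
  have h₂ : ∀ a b₁, X ∘L tensorRight _ (pureTensor a b₁) = Y ∘L tensorRight _ (pureTensor a b₁) :=
    fun a b₁ => ext_pureTensor fun b₂ c => h₁ a b₁ b₂ c
  have h₃ : ∀ q, X ∘L tensorLeft _ q = Y ∘L tensorLeft _ q :=
    fun q => ext_pureTensor fun a b₁ => DFunLike.congr_fun (h₂ a b₁) q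
  exact ext_pureTensor fun p q => DFunLike.congr_fun (h₃ q) p

end Parties

/-! ### Density operators have eigenbases -/

section Spectral

universe u

variable {H : Type u} [NormedAddCommGroup H] [InnerProductSpace ℝ H]

/-- `HasTrace` only speaks of bases indexed by subsets of `H`; any other basis is reindexed by its
range. -/
theorem HasTrace.hasSum [CompleteSpace H] {T : H →L[ℝ] H} {t : ℝ} (h : HasTrace T t) {ι : Type*}
    (e : HilbertBasis ι ℝ H) : HasSum (fun i => inner ℝ (e i) (T (e i))) t := by
  have hinj : Function.Injective e := e.orthonormal.linearIndependent.injective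
  let e' : HilbertBasis (Set.range e) ℝ H :=
    HilbertBasis.mk e.orthonormal.toSubtypeRange
      (by rw [Subtype.range_coe]; exact e.dense_span.ge)
  have he' : ∀ x, e' x = x := fun x => by simp [e']
  have := h _ e'
  simp only [he'] at this
  exact (Equiv.hasSum_iff (Equiv.ofInjective e hinj)).2 this

/-- Positivity is tested on `x - M⁻¹ • T x`; the added `1` in `M` keeps it invertible when `T = 0`.
Summed over a basis, the bound makes an operator with a trace Hilbert–Schmidt. -/
theorem norm_sq_apply_le_of_isPositive {T : H →L[ℝ] H} (hT : T.IsPositive) (x : H) :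
    ‖T x‖ ^ 2 ≤ (‖T‖ + 1) * inner ℝ x (T x) := by
  set M := ‖T‖ + 1 with hM
  have hMpos : 0 < M := by positivity
  have h₁ : inner ℝ (T x) (T (T x)) ≤ M * ‖T x‖ ^ 2 := by
    have h₂ := real_inner_le_norm (T x) (T (T x))
    have h₃ := T.le_opNorm (T x)
    nlinarith [norm_nonneg (T x)]
  have h₂ := hT.inner_nonneg_right (x - M⁻¹ • T x)
  have h₃ : inner ℝ x (T (T x)) = ‖T x‖ ^ 2 := by
    rw [← hT.inner_left_eq_inner_right, real_inner_self_eq_norm_sq]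
  simp only [map_sub, map_smul, inner_sub_left, inner_sub_right, inner_smul_left,
    inner_smul_right, real_inner_self_eq_norm_sq, h₃, conj_trivial] at h₂
  have h₄ := mul_nonneg (mul_nonneg hMpos.le hMpos.le) h₂
  field_simp at h₄
  nlinarith

/-- A positive operator with a convergent trace is compact. -/
theorem isCompactOperator_of_hasTrace [CompleteSpace H] {T : H →L[ℝ] H} (hT : T.IsPositive)
    {t : ℝ} (h : HasTrace T t) : IsCompactOperator T := by
  obtain ⟨w, e, -⟩ := exists_hilbertBasis ℝ H
  let f : w → H →L[ℝ] H := fun i => (innerSL ℝ (e i)).smulRight (T (e i))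
  have hsq : Summable fun i => ‖T (e i)‖ ^ 2 :=
    Summable.of_nonneg_of_le (fun _ => by positivity)
      (fun i => norm_sq_apply_le_of_isPositive hT (e i)) ((h w e).summable.mul_left _)
  -- The Hilbert–Schmidt norm dominates the operator norm, by Cauchy–Schwarz and Bessel. The
  -- rank-one pieces of `T` are therefore summable in operator norm, and `T` is a norm limit of
  -- finite-rank operators.
  have hbound : ∀ s : Finset w, ‖∑ i ∈ s, f i‖ ≤ √(∑ i ∈ s, ‖T (e i)‖ ^ 2) := by
    intro s
    refine ContinuousLinearMap.opNorm_le_bound _ (Real.sqrt_nonneg _) fun x => ?_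
    rw [sum_apply]
    calc ‖∑ i ∈ s, f i x‖ ≤ ∑ i ∈ s, ‖f i x‖ := norm_sum_le _ _
      _ = ∑ i ∈ s, ‖T (e i)‖ * ‖inner ℝ (e i) x‖ :=
        Finset.sum_congr rfl fun i _ => by simp [f, norm_smul, mul_comm]
      _ ≤ √(∑ i ∈ s, ‖T (e i)‖ ^ 2) * √(∑ i ∈ s, ‖inner ℝ (e i) x‖ ^ 2) :=
        Real.sum_mul_le_sqrt_mul_sqrt _ _ _
      _ ≤ √(∑ i ∈ s, ‖T (e i)‖ ^ 2) * ‖x‖ := by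
        gcongr
        rw [Real.sqrt_le_left (norm_nonneg x)]
        exact e.orthonormal.sum_inner_products_le x
  have hf : Summable f := by
    rw [summable_iff_vanishing_norm]
    intro ε hε
    obtain ⟨s, hs⟩ := summable_iff_vanishing_norm.1 hsq (ε ^ 2) (by positivity)
    refine ⟨s, fun u hu => (hbound u).trans_lt ?_⟩
    rw [Real.sqrt_lt' hε]
    exact (le_abs_self _).trans_lt (hs u hu)
  have hTf : HasSum f T := by
    convert hf.hasSum
    ext x
    have h₁ := (e.hasSum_repr x).mapL T
    have h₂ : HasSum (fun i => f i x) ((∑' i, f i) x) :=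
      hf.hasSum.mapL (ContinuousLinearMap.apply ℝ H x)
    have h₃ : (fun i => T (e.repr x i • e i)) = fun i => f i x := by
      funext i
      simp [f, e.repr_apply_apply]
    exact (h₃ ▸ h₁).unique h₂
  refine isCompactOperator_of_tendsto hTf (Filter.Eventually.of_forall fun s => ?_)
  refine (compactOperator (RingHom.id ℝ) H H).sum_mem fun i _ => ?_
  exact (isCompactOperator_of_locallyCompactSpace_rng
    (ContinuousLinearMap.toSpanSingleton ℝ (T (e i)))).comp_clm (innerSL ℝ (e i))

/-- Bases of all the eigenspaces, the kernel included, are put together; the spectral theorem for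
compact symmetric operators leaves nothing orthogonal to them. -/
theorem exists_hilbertBasis_eigenvectors [CompleteSpace H] {T : H →L[ℝ] H}
    (hT : (T : H →ₗ[ℝ] H).IsSymmetric) (hc : IsCompactOperator T) :
    ∃ (ι : Type u) (e : HilbertBasis ι ℝ H) (μ : ι → ℝ), ∀ i, T (e i) = μ i • e i := by
  have hO := hT.orthogonalFamily_eigenspaces
  have hbot := T.orthogonalComplement_iSup_eigenspaces_eq_bot hc hT
  have hex := fun μ : ℝ => exists_hilbertBasis ℝ (Module.End.eigenspace (T : Module.End ℝ H) μ)
  choose w b hb using hex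
  have hon : Orthonormal ℝ fun a : Σ μ, w μ => (b a.1 a.2 : H) :=
    hO.orthonormal_sigma_orthonormal (fun μ => (b μ).orthonormal)
  have hspan : (Submodule.span ℝ (Set.range fun a : Σ μ, w μ => (b a.1 a.2 : H)))ᗮ = ⊥ := by
    rw [eq_bot_iff, ← hbot, ← Submodule.iInf_orthogonal]
    refine le_iInf fun μ z hz => (Submodule.mem_orthogonal' _ _).2 fun y hy => ?_
    have h₀ : innerSL ℝ z ∘L (Module.End.eigenspace (T : Module.End ℝ H) μ).subtypeL = 0 :=
      HilbertBasis.clm_ext (b μ) fun i =>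
        (Submodule.mem_orthogonal' _ _).1 hz _ (Submodule.subset_span ⟨⟨μ, i⟩, rfl⟩)
    exact DFunLike.congr_fun h₀ ⟨y, hy⟩
  refine ⟨Σ μ, w μ, HilbertBasis.mkOfOrthogonalEqBot hon hspan, fun i => i.1, fun i => ?_⟩
  rw [HilbertBasis.coe_mkOfOrthogonalEqBot]
  exact Module.End.mem_eigenspace_iff.1 (b i.1 i.2).2

/-- The spectral decomposition of a density operator. -/
theorem IsState.exists_eigenbasis [CompleteSpace H] {T : H →L[ℝ] H} (hT : IsState T) :
    ∃ (ι : Type u) (e : HilbertBasis ι ℝ H) (μ : ι → ℝ),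
      (∀ i, T (e i) = μ i • e i) ∧ (∀ i, 0 ≤ μ i) ∧ ∃ i, 0 < μ i := by
  obtain ⟨ι, e, μ, he⟩ := exists_hilbertBasis_eigenvectors hT.1.isSymmetric
    (isCompactOperator_of_hasTrace hT.1 hT.2)
  have hμ : ∀ i, inner ℝ (e i) (T (e i)) = μ i := fun i => by
    simp [he, inner_smul_right, e.orthonormal.1]
  have hnn : ∀ i, 0 ≤ μ i := fun i => hμ i ▸ hT.1.inner_nonneg_right (e i)
  refine ⟨ι, e, μ, he, hnn, ?_⟩
  by_contra! hle
  have h₀ : μ = 0 := funext fun i => le_antisymm (hle i) (hnn i)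
  have := hT.2.hasSum e
  simp only [hμ, h₀] at this
  exact zero_ne_one (hasSum_zero.unique this)

end Spectral

/-! ### Reversal of operator products on a correlated vector -/

section Algebra

/-- A vector on which the observables of Alice act like, up to signs, the "Pauli" observables of
Charlie: the product of Alice's observables is reversed by those of Charlie. -/
theorem triple_product_of_correlated {V : Type*} [NormedAddCommGroup V] [NormedSpace ℝ V]
    {a₀ a₁ a₂ z x z' y' x' y'' : V →L[ℝ] V} {s₀ s₁ s₂ : ℝ}
    (hs : s₀ * s₁ * s₂ = -1)
    (hzx : z * x = -(x * z)) (hzy : z' * y' = -(y' * z')) (hxy : x' * y'' = -(y'' * x'))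
    (h₀ : ∀ c ∈ ({z, x, y', z', x', y''} : Set (V →L[ℝ] V)), Commute a₀ c)
    (h₁ : ∀ c ∈ ({z, x, y', z', x', y''} : Set (V →L[ℝ] V)), Commute a₁ c)
    (h₂ : ∀ c ∈ ({z, x, y', z', x', y''} : Set (V →L[ℝ] V)), Commute a₂ c)
    {w : V} (e₀ : a₀ w = s₀ • z w) (e₀' : a₀ w = s₀ • z' w)
    (e₁ : a₁ w = s₁ • x w) (e₁' : a₁ w = s₁ • x' w)
    (e₂ : a₂ w = s₂ • y' w) (e₂' : a₂ w = s₂ • y'' w) :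
    a₀ (a₁ (a₂ w)) - a₂ (a₁ (a₀ w)) = z (x (y' w)) - y' (x (z w)) ∧
      a₂ (a₁ (a₀ w)) = -a₀ (a₁ (a₂ w)) := by
  have app : ∀ {a c : V →L[ℝ] V}, Commute a c → ∀ v, a (c v) = c (a v) :=
    fun h v => DFunLike.congr_fun h.eq v
  have neg : ∀ {c d : V →L[ℝ] V}, c * d = -(d * c) → ∀ v, c (d v) = -d (c v) :=
    fun h v => DFunLike.congr_fun h v
  -- Only Charlie's operators anticommute as operators. Alice's do so on `w` alone: the inner one is
  -- traded for Charlie's, the outer one passes it and is traded too.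
  have h₀₁ : a₁ (a₀ w) = -a₀ (a₁ w) := by
    rw [e₀, e₁, map_smul, map_smul, app (h₁ z (by simp)), app (h₀ x (by simp)), e₀, e₁, map_smul,
      map_smul, neg hzx]
    module
  have h₀₂ : a₂ (a₀ w) = -a₀ (a₂ w) := by
    rw [e₀', e₂, map_smul, map_smul, app (h₂ z' (by simp)), app (h₀ y' (by simp)), e₀', e₂,
      map_smul, map_smul, neg hzy]
    module
  have h₁₂ : a₂ (a₁ w) = -a₁ (a₂ w) := by
    rw [e₁', e₂', map_smul, map_smul, app (h₂ x' (by simp)), app (h₁ y'' (by simp)), e₁', e₂',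
      map_smul, map_smul, neg hxy]
    module
  -- Each factor, from the innermost out, becomes Charlie's and is pulled to the left, so the order
  -- is reversed.
  have e₀₁₂ : a₀ (a₁ (a₂ w)) = -y' (x (z w)) := by
    rw [e₂, map_smul, map_smul, app (h₁ y' (by simp)), app (h₀ y' (by simp)), e₁, map_smul,
      app (h₀ x (by simp)), e₀]
    simp only [map_smul, smul_smul]
    rw [show s₂ * (s₁ * s₀) = -1 by linarith, neg_one_smul]
  have e₂₁₀ : a₂ (a₁ (a₀ w)) = -z (x (y' w)) := by
    rw [e₀, map_smul, map_smul, app (h₁ z (by simp)), app (h₂ z (by simp)), e₁, map_smul,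
      app (h₂ x (by simp)), e₂]
    simp only [map_smul, smul_smul]
    rw [show s₀ * (s₁ * s₂) = -1 by linarith, neg_one_smul]
  refine ⟨by rw [e₀₁₂, e₂₁₀]; abel, ?_⟩
  -- Three swaps give an odd sign. A swap is available only next to `w`, so the innermost factor is
  -- parked as an operator of Charlie while the other two are exchanged.
  calc a₂ (a₁ (a₀ w)) = s₀ • z (a₂ (a₁ w)) := by
        rw [e₀, map_smul, map_smul, app (h₁ z (by simp)), app (h₂ z (by simp))]
    _ = -a₁ (a₂ (a₀ w)) := by
        rw [h₁₂, e₀, map_smul, map_smul, app (h₂ z (by simp)), app (h₁ z (by simp)), map_neg,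
          smul_neg]
    _ = s₂ • y' (a₁ (a₀ w)) := by
        rw [h₀₂, map_neg, neg_neg, e₂, map_smul, map_smul, app (h₀ y' (by simp)),
          app (h₁ y' (by simp))]
    _ = -a₀ (a₁ (a₂ w)) := by
        rw [h₀₁, e₂, map_smul, map_smul, app (h₁ y' (by simp)), app (h₀ y' (by simp)), map_neg,
          smul_neg]

end Algebra

/-! ### Tsirelson's bound as a sum of squares -/

section CHSH

variable {V : Type*} [NormedAddCommGroup V] [InnerProductSpace ℝ V]

/-- The sum-of-squares identity behind the Tsirelson bound. -/
theorem chsh_gap_eq {p q d e : V} {r : ℝ} (hp : ‖p‖ ^ 2 = r) (hq : ‖q‖ ^ 2 = r)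
    (hd : ‖d‖ ^ 2 = r) (he : ‖e‖ ^ 2 = r) :
    2 * √2 * r - (inner ℝ p d + inner ℝ p e + (inner ℝ q d - inner ℝ q e)) =
      (√2)⁻¹ * (‖p - (√2)⁻¹ • (d + e)‖ ^ 2 + ‖q - (√2)⁻¹ • (d - e)‖ ^ 2) := by
  have h2 : √2 ^ 2 = 2 := Real.sq_sqrt (by norm_num)
  have h0 : √2 ≠ 0 := by positivity
  simp only [← real_inner_self_eq_norm_sq, inner_sub_left, inner_sub_right, inner_add_left,
    inner_add_right, inner_smul_left, inner_smul_right, conj_trivial,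
    real_inner_comm p, real_inner_comm q, real_inner_comm d e] at *
  rw [hp, hq, hd, he]
  field_simp
  linear_combination (√2 * (2 * √2 * r -
    (inner ℝ p d + inner ℝ p e + (inner ℝ q d - inner ℝ q e))) + 2 * r) * h2

end CHSH

/-! ### The ideal correlation and its CHSH values -/

theorem invSqrtTwo_sq : invSqrtTwo * invSqrtTwo = 1 / 2 := by
  rw [invSqrtTwo, ← Complex.ofReal_mul]
  rw [show (1 / √2 * (1 / √2) : ℝ) = 1 / 2 by field_simp; simp]
  simp

/-- Entanglement swapping: `Φ⁺` has entries `1/2` exactly where the indices of its two qubits agree,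
so Bob's projection is contracted directly with the outer operators, up to a transpose. -/
theorem trace_sources_mul (M N : Matrix (Fin 2) (Fin 2) ℂ) (b : Fin 2 × Fin 2) :
    Matrix.trace ((bellProj (0, 0) ⊗ₖ bellProj (0, 0)) *
      (M ⊗ₖ (bellProj b ⊗ₖ N)).submatrix regroupIndex regroupIndex) =
      1 / 4 * ∑ i, ∑ j, ∑ k, ∑ l, bellProj b (i, j) (k, l) * M i k * N j l := by
  have hΦ : ∀ i j, bellVector (0, 0) (i, j) = if i = j then invSqrtTwo else 0 := by
    intro i j
    fin_cases i <;> fin_cases j <;> simp [bellVector, ket]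
  have hs : star invSqrtTwo = invSqrtTwo := by simp [invSqrtTwo]
  have hP : ∀ i j k l, bellProj (0, 0) (i, j) (k, l) =
      if i = j then (if k = l then 1 / 2 else 0) else 0 := by
    intro i j k l
    simp only [bellProj, Matrix.vecMulVec_apply, hΦ, Pi.star_apply]
    split_ifs <;> simp [hs, invSqrtTwo_sq]
  simp only [Matrix.trace, Matrix.diag, Matrix.mul_apply, Matrix.kroneckerMap_apply,
    Matrix.submatrix_apply, regroupIndex, Fintype.sum_prod_type, hP, Fin.sum_univ_two]
  simp
  ring

/-- The observable `n₀ σ_Z + n₁ σ_X + n₂ σ_Y`. -/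
def pauliCombination (n : Fin 3 → ℝ) : Matrix (Fin 2) (Fin 2) ℂ :=
  (n 0 : ℂ) • pauliZ + (n 1 : ℂ) • pauliX + (n 2 : ℂ) • pauliY

/-- The correlations of `σ_Z ⊗ σ_Z`, `σ_X ⊗ σ_X`, `σ_Y ⊗ σ_Y` in the Bell states. -/
def bellSign : Fin 2 × Fin 2 → Fin 3 → ℝ
  | (0, 0) => ![1, 1, -1]
  | (0, 1) => ![-1, 1, 1]
  | (1, 0) => ![1, -1, 1]
  | (1, 1) => ![-1, -1, -1]

/-- The product does not depend on `b`; this lets the triple-product identity be summed over Bob's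
outcomes. -/
theorem bellSign_prod (b : Fin 2 × Fin 2) :
    bellSign b 0 * bellSign b 1 * bellSign b 2 = -1 := by
  fin_cases b <;> simp [bellSign]

theorem bellSign_sq (b : Fin 2 × Fin 2) (x : Fin 3) : bellSign b x ^ 2 = 1 := by
  fin_cases b <;> fin_cases x <;> simp [bellSign]

/-- Bell states have no local means and a diagonal correlation matrix. The transposition flips `σ_Y`
on both sides, so its diagonal entry keeps its sign. -/
theorem bell_expectation (b : Fin 2 × Fin 2) (a c : ℤˣ) (n m : Fin 3 → ℝ) :
    ∑ i, ∑ j, ∑ k, ∑ l, bellProj b (i, j) (k, l) * outcomeProj (pauliCombination n) a i k *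
      outcomeProj (pauliCombination m) c j l =
      ((1 / 4 * (1 + a * c * ∑ i, bellSign b i * n i * m i) : ℝ) : ℂ) := by
  have hs : star invSqrtTwo = invSqrtTwo := by simp [invSqrtTwo]
  have hI := Complex.I_mul_I
  have h2 := invSqrtTwo_sq
  obtain ⟨b₁, b₂⟩ := b
  fin_cases b₁ <;> fin_cases b₂ <;>
  · simp [Fin.sum_univ_succ, bellProj, Matrix.vecMulVec_apply, bellVector, ket, hs, h2,
      outcomeProj, pauliCombination, pauliZ, pauliX, pauliY, bellSign, Pi.single_apply]
    ring_nf
    simp only [Complex.I_sq]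
    ring_nf

/-- The Bloch vectors of Alice's observables. -/
def aliceBloch (x : Fin 3) : Fin 3 → ℝ := Pi.single x 1

/-- The Bloch vectors of Charlie's observables. -/
def charlieBloch : Fin 6 → Fin 3 → ℝ :=
  ![![1 / √2, 1 / √2, 0], ![1 / √2, -(1 / √2), 0], ![1 / √2, 0, 1 / √2], ![1 / √2, 0, -(1 / √2)],
    ![0, 1 / √2, 1 / √2], ![0, 1 / √2, -(1 / √2)]]

theorem aliceObservable_eq (x : Fin 3) : aliceObservable x = pauliCombination (aliceBloch x) := by
  fin_cases x <;> simp [aliceObservable, pauliCombination, aliceBloch]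

theorem charlieObservable_eq (z : Fin 6) :
    charlieObservable z = pauliCombination (charlieBloch z) := by
  fin_cases z <;>
    simp [charlieObservable, pauliCombination, charlieBloch, invSqrtTwo, sub_eq_add_neg]

theorem idealCorrelation_eq (a : ℤˣ) (b : Fin 2 × Fin 2) (c : ℤˣ) (x : Fin 3) (z : Fin 6) :
    idealCorrelation a b c x z = 1 / 16 * (1 + a * c * (bellSign b x * charlieBloch z x)) := by
  rw [idealCorrelation, trace_sources_mul, aliceObservable_eq, charlieObservable_eq,
    bell_expectation]
  rw [show (1 / 4 : ℂ) = ((1 / 4 : ℝ) : ℂ) by norm_num, ← Complex.ofReal_mul, Complex.ofReal_re]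
  simp [aliceBloch, Pi.single_apply]
  ring

/-- The unnormalized correlator of Alice and Charlie, given the outcome `b` of Bob. -/
def correlator (b : Fin 2 × Fin 2) (x : Fin 3) (z : Fin 6) (P : Correlation) : ℝ :=
  ∑ a : ℤˣ, ∑ c : ℤˣ, (a : ℝ) * c * P a b c x z

/-- The difference between the Tsirelson bound and the CHSH value of a correlation, for Alice's
settings `x, x'` and Charlie's settings `z, z'`, given the outcome `b` of Bob. -/
def chshGap (b : Fin 2 × Fin 2) (x x' : Fin 3) (z z' : Fin 6) : Correlation →ₗ[ℝ] ℝ where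
  toFun P := 2 * √2 * (∑ a : ℤˣ, ∑ c : ℤˣ, P a b c x z) -
    (bellSign b x * (correlator b x z P + correlator b x z' P) +
      bellSign b x' * (correlator b x' z P - correlator b x' z' P))
  map_add' P Q := by
    simp only [correlator, Pi.add_apply, mul_add, Finset.sum_add_distrib]
    ring
  map_smul' t P := by
    simp only [correlator, Pi.smul_apply, smul_eq_mul, mul_left_comm _ t, ← Finset.mul_sum,
      RingHom.id_apply]
    ring

/-- The hypotheses say that Charlie's directions bisect the axes `x` and `±x'`. Each of the four
signed correlators is then `1 / (4√2)`, against the weight `1/4` of the outcome `b`. -/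
theorem chshGap_idealCorrelation (b : Fin 2 × Fin 2) {x x' : Fin 3} {z z' : Fin 6}
    (h₁ : charlieBloch z x = 1 / √2) (h₂ : charlieBloch z' x = 1 / √2)
    (h₃ : charlieBloch z x' = 1 / √2) (h₄ : charlieBloch z' x' = -(1 / √2)) :
    chshGap b x x' z z' idealCorrelation = 0 := by
  have hx := bellSign_sq b x
  have hx' := bellSign_sq b x'
  have h2 : √2 ^ 2 = 2 := Real.sq_sqrt (by norm_num)
  have h0 : √2 ≠ 0 := by positivity
  have huniv : ∀ f : ℤˣ → ℝ, ∑ a, f a = f 1 + f (-1) := fun f => by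
    rw [UnitsInt.univ, Finset.sum_pair (by decide)]
  simp only [chshGap, correlator, LinearMap.coe_mk, AddHom.coe_mk, idealCorrelation_eq, h₁, h₂,
    h₃, h₄, huniv]
  push_cast
  field_simp
  ring_nf
  rw [hx, hx', h2]
  norm_num

/-! ### Observables of two-outcome measurements -/

section Measurements

/-- The observable with eigenvalues `±1` of a two-outcome measurement. -/
def observable {R : Type*} [Ring R] (M : ℤˣ → R) : R := M 1 - M (-1)

theorem map_observable {R S F : Type*} [Ring R] [Ring S] [FunLike F R S] [AddMonoidHomClass F R S]
    (φ : F) (M : ℤˣ → R) : φ (observable M) = observable fun a => φ (M a) := by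
  simp [observable]

theorem sum_intUnits {N : Type*} [AddCommMonoid N] (f : ℤˣ → N) : ∑ a, f a = f 1 + f (-1) := by
  rw [UnitsInt.univ, Finset.sum_pair (by decide)]

variable {H K : Type*} [NormedAddCommGroup H] [InnerProductSpace ℝ H] [CompleteSpace H]
  [NormedAddCommGroup K] [InnerProductSpace ℝ K] [CompleteSpace K]

theorem IsProjectiveMeasurement.map {R : Type*} [Fintype R] {M : R → (H →L[ℝ] H)}
    (hM : IsProjectiveMeasurement M) (φ : (H →L[ℝ] H) →⋆ₐ[ℝ] (K →L[ℝ] K)) :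
    IsProjectiveMeasurement fun r => φ (M r) :=
  ⟨fun r => (hM.1 r).map φ, by rw [← map_sum, hM.2, map_one]⟩

theorem IsProjectiveMeasurement.star_observable {M : ℤˣ → (H →L[ℝ] H)}
    (hM : IsProjectiveMeasurement M) : star (observable M) = observable M := by
  rw [observable, star_sub, (hM.1 1).isSelfAdjoint.star_eq, (hM.1 (-1)).isSelfAdjoint.star_eq]

theorem IsProjectiveMeasurement.observable_mul_self {M : ℤˣ → (H →L[ℝ] H)}
    (hM : IsProjectiveMeasurement M) : observable M * observable M = 1 := by
  have h₁ := hM.2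
  rw [sum_intUnits] at h₁
  have h₂ : M (-1) = 1 - M 1 := eq_sub_of_add_eq' h₁
  have h₃ : M 1 * M 1 = M 1 := (hM.1 1).isIdempotentElem
  rw [observable, h₂]
  simp only [sub_mul, mul_sub, h₃, one_mul, mul_one]
  abel

theorem inner_apply_eq_of_star_eq {S : H →L[ℝ] H} (hS : star S = S) (x y : H) :
    inner ℝ (S x) y = inner ℝ x (S y) := by
  conv_lhs => rw [← hS, ContinuousLinearMap.star_eq_adjoint, ContinuousLinearMap.adjoint_inner_left]

theorem norm_observable_apply {M : ℤˣ → (H →L[ℝ] H)} (hM : IsProjectiveMeasurement M) (x : H) :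
    ‖observable M x‖ ^ 2 = ‖x‖ ^ 2 := by
  rw [← real_inner_self_eq_norm_sq, inner_apply_eq_of_star_eq hM.star_observable,
    show observable M (observable M x) = (observable M * observable M) x from rfl,
    hM.observable_mul_self, ← real_inner_self_eq_norm_sq]
  rfl

end Measurements

/-! ### Commuting measurements in a pure state -/

section CommutingModel

variable {W : Type*} [NormedAddCommGroup W] [InnerProductSpace ℝ W]

/-- The correlation of commuting measurements in the pure state `u`. -/
def vectorCorrelation (α : Fin 3 → ℤˣ → (W →L[ℝ] W)) (β : Fin 2 × Fin 2 → (W →L[ℝ] W))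
    (γ : Fin 6 → ℤˣ → (W →L[ℝ] W)) (u : W) : Correlation :=
  fun a b c x z => inner ℝ u ((α x a * (β b * γ z c)) u)

variable [CompleteSpace W] {α : Fin 3 → ℤˣ → (W →L[ℝ] W)} {β : Fin 2 × Fin 2 → (W →L[ℝ] W)}
  {γ : Fin 6 → ℤˣ → (W →L[ℝ] W)}

/-- Bob's projection is idempotent and commutes with the rest, so conditioning on `b` replaces `u`
by the unnormalized vector `β b u`. -/
theorem vectorCorrelation_eq (hα : ∀ x, IsProjectiveMeasurement (α x))
    (hβ : IsProjectiveMeasurement β)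
    (hαβ : ∀ x a b, Commute (α x a) (β b)) (hβγ : ∀ z c b, Commute (β b) (γ z c))
    (u : W) (a : ℤˣ) (b : Fin 2 × Fin 2) (c : ℤˣ) (x : Fin 3) (z : Fin 6) :
    vectorCorrelation α β γ u a b c x z = inner ℝ (α x a (β b u)) (γ z c (β b u)) := by
  have h : α x a * (β b * γ z c) = β b * (α x a * (γ z c * β b)) := by
    rw [← (hβγ z c b).eq, ← mul_assoc (α x a), (hαβ x a b).eq, mul_assoc (β b) (α x a),
      ← mul_assoc (β b) (β b), (hβ.1 b).isIdempotentElem.eq]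
  rw [vectorCorrelation, h]
  change inner ℝ u (β b (α x a (γ z c (β b u)))) = _
  rw [← inner_apply_eq_of_star_eq (hβ.1 b).isSelfAdjoint.star_eq,
    ← inner_apply_eq_of_star_eq ((hα x).1 a).isSelfAdjoint.star_eq]

/-- Observables are isometric, so `chsh_gap_eq` applies with all four squared norms equal to `‖β b
u‖ ^ 2`. -/
theorem chshGap_vectorCorrelation (hα : ∀ x, IsProjectiveMeasurement (α x))
    (hβ : IsProjectiveMeasurement β) (hγ : ∀ z, IsProjectiveMeasurement (γ z))
    (hαβ : ∀ x a b, Commute (α x a) (β b)) (hβγ : ∀ z c b, Commute (β b) (γ z c))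
    (u : W) (b : Fin 2 × Fin 2) (x x' : Fin 3) (z z' : Fin 6) :
    chshGap b x x' z z' (vectorCorrelation α β γ u) =
      (√2)⁻¹ * (‖bellSign b x • observable (α x) (β b u) -
        (√2)⁻¹ • (observable (γ z) (β b u) + observable (γ z') (β b u))‖ ^ 2 +
      ‖bellSign b x' • observable (α x') (β b u) -
        (√2)⁻¹ • (observable (γ z) (β b u) - observable (γ z') (β b u))‖ ^ 2) := by
  set w := β b u with hw
  have hs : ∀ y, ‖bellSign b y • observable (α y) w‖ ^ 2 = ‖w‖ ^ 2 := fun y => by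
    rw [norm_smul, mul_pow, norm_observable_apply (hα y), Real.norm_eq_abs, sq_abs, bellSign_sq,
      one_mul]
  rw [← chsh_gap_eq (hs x) (hs x') (norm_observable_apply (hγ z) w)
    (norm_observable_apply (hγ z') w)]
  have hc : ∀ y t, correlator b y t (vectorCorrelation α β γ u) =
      inner ℝ (observable (α y) w) (observable (γ t) w) := fun y t => by
    simp only [correlator, vectorCorrelation_eq hα hβ hαβ hβγ, sum_intUnits, observable,
      sub_apply, inner_sub_left, inner_sub_right, ← hw]
    push_cast
    ring
  have h1 : ∑ a : ℤˣ, ∑ c : ℤˣ, vectorCorrelation α β γ u a b c x z = ‖w‖ ^ 2 := by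
    simp only [vectorCorrelation_eq hα hβ hαβ hβγ, ← inner_sum, ← sum_inner, ← hw]
    rw [← sum_apply, ← sum_apply, (hα x).2, (hγ z).2]
    simp
  simp only [chshGap, LinearMap.coe_mk, AddHom.coe_mk, hc, h1, inner_smul_left, conj_trivial]
  ring

theorem chshGap_vectorCorrelation_nonneg (hα : ∀ x, IsProjectiveMeasurement (α x))
    (hβ : IsProjectiveMeasurement β) (hγ : ∀ z, IsProjectiveMeasurement (γ z))
    (hαβ : ∀ x a b, Commute (α x a) (β b)) (hβγ : ∀ z c b, Commute (β b) (γ z c))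
    (u : W) (b : Fin 2 × Fin 2) (x x' : Fin 3) (z z' : Fin 6) :
    0 ≤ chshGap b x x' z z' (vectorCorrelation α β γ u) := by
  rw [chshGap_vectorCorrelation hα hβ hγ hαβ hβγ]
  positivity

/-- Saturation of the Tsirelson bound ties Alice's observables to those of Charlie. -/
theorem observable_apply_of_chshGap_eq_zero (hα : ∀ x, IsProjectiveMeasurement (α x))
    (hβ : IsProjectiveMeasurement β) (hγ : ∀ z, IsProjectiveMeasurement (γ z))
    (hαβ : ∀ x a b, Commute (α x a) (β b)) (hβγ : ∀ z c b, Commute (β b) (γ z c))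
    {u : W} {b : Fin 2 × Fin 2} {x x' : Fin 3} {z z' : Fin 6}
    (h : chshGap b x x' z z' (vectorCorrelation α β γ u) = 0) :
    observable (α x) (β b u) =
        bellSign b x • ((√2)⁻¹ • (observable (γ z) + observable (γ z'))) (β b u) ∧
      observable (α x') (β b u) =
        bellSign b x' • ((√2)⁻¹ • (observable (γ z) - observable (γ z'))) (β b u) := by
  rw [chshGap_vectorCorrelation hα hβ hγ hαβ hβγ, mul_eq_zero,
    or_iff_right (by positivity), add_eq_zero_iff_of_nonneg (by positivity) (by positivity)] at h
  simp only [ne_eq, OfNat.ofNat_ne_zero, not_false_eq_true, pow_eq_zero_iff, norm_eq_zero,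
    sub_eq_zero] at h
  have hs : ∀ y (v v' : W), bellSign b y • v = v' → v = bellSign b y • v' := fun y v v' e => by
    rw [← e, smul_smul, ← sq, bellSign_sq, one_smul]
  exact ⟨hs _ _ _ h.1, hs _ _ _ h.2⟩

/-- The squares of `d` and `e` cancel and only their commutator survives. The identity holds for
operators, whatever the state. -/
theorem anticommute_add_sub {R : Type*} [Ring R] [Algebra ℝ R] {d e : R} (hd : d * d = 1)
    (he : e * e = 1) (t : ℝ) :
    (t • (d + e)) * (t • (d - e)) = -((t • (d - e)) * (t • (d + e))) := by
  simp only [smul_mul_smul_comm, ← smul_neg]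
  congr 1
  simp only [add_mul, sub_mul, mul_add, mul_sub, hd, he]
  abel

/-- The antisymmetrized triple product `xyz - zyx`. -/
def tripleCommutator {R : Type*} [Ring R] (x y z : R) : R := x * y * z - z * y * x

theorem star_tripleCommutator {R : Type*} [Ring R] [StarRing R] {x y z : R} (hx : star x = x)
    (hy : star y = y) (hz : star z = z) :
    star (tripleCommutator x y z) = -tripleCommutator x y z := by
  simp [tripleCommutator, hx, hy, hz, mul_assoc]

/-- Charlie's estimates of the Pauli observables `σ_Z, σ_X, σ_Y`. -/
def charliePauli {R : Type*} [Ring R] [Algebra ℝ R] (c : Fin 6 → R) : Fin 3 → R :=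
  ![(√2)⁻¹ • (c 0 + c 1), (√2)⁻¹ • (c 0 - c 1), (√2)⁻¹ • (c 2 - c 3)]

/-- The vanishing expectation in `horth` equals `-‖T u‖²` once `T u = S u` is known, whereas
anticommutation forces `T u` to be as large as `2‖u‖`. -/
theorem eq_zero_of_chshGap_eq_zero (hα : ∀ x, IsProjectiveMeasurement (α x))
    (hβ : IsProjectiveMeasurement β) (hγ : ∀ z, IsProjectiveMeasurement (γ z))
    (hαβ : ∀ x a b, Commute (α x a) (β b)) (hβγ : ∀ z c b, Commute (β b) (γ z c))
    (hαγ : ∀ x a z c, Commute (α x a) (γ z c)) {u : W}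
    (h₀₁ : ∀ b, chshGap b 0 1 0 1 (vectorCorrelation α β γ u) = 0)
    (h₀₂ : ∀ b, chshGap b 0 2 2 3 (vectorCorrelation α β γ u) = 0)
    (h₁₂ : ∀ b, chshGap b 1 2 4 5 (vectorCorrelation α β γ u) = 0)
    (horth : inner ℝ u ((tripleCommutator (observable (α 0)) (observable (α 1))
      (observable (α 2)) * tripleCommutator (charliePauli (fun z => observable (γ z)) 0)
        (charliePauli (fun z => observable (γ z)) 1)
        (charliePauli (fun z => observable (γ z)) 2)) u) = 0) : u = 0 := by
  set a := fun x => observable (α x) with ha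
  set c := fun z => observable (γ z) with hc
  set k := charliePauli c with hk
  have hac : ∀ x z, Commute (a x) (c z) := fun x z =>
    ((hαγ _ _ _ _).sub_left (hαγ _ _ _ _)).sub_right ((hαγ _ _ _ _).sub_left (hαγ _ _ _ _))
  have hcc : ∀ z, c z * c z = 1 := fun z => (hγ z).observable_mul_self
  have hcom : ∀ x, ∀ t ∈ ({k 0, k 1, k 2, (√2)⁻¹ • (c 2 + c 3), (√2)⁻¹ • (c 4 + c 5),
      (√2)⁻¹ • (c 4 - c 5)} : Set (W →L[ℝ] W)), Commute (a x) t := by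
    intro x t ht
    simp only [Set.mem_insert_iff, Set.mem_singleton_iff] at ht
    rcases ht with rfl | rfl | rfl | rfl | rfl | rfl
    all_goals
      first
        | exact ((hac x _).add_right (hac x _)).smul_right _
        | exact ((hac x _).sub_right (hac x _)).smul_right _
  -- Every `a x` occurs in two of the three tests and so matches two operators of Charlie; the
  -- second match is needed only for the anticommutation of the remaining pairs.
  have key : ∀ b, a 0 (a 1 (a 2 (β b u))) - a 2 (a 1 (a 0 (β b u))) =
      k 0 (k 1 (k 2 (β b u))) - k 2 (k 1 (k 0 (β b u))) ∧
      a 2 (a 1 (a 0 (β b u))) = -a 0 (a 1 (a 2 (β b u))) := by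
    intro b
    obtain ⟨e₀, e₁⟩ := observable_apply_of_chshGap_eq_zero hα hβ hγ hαβ hβγ (h₀₁ b)
    obtain ⟨e₀', e₂⟩ := observable_apply_of_chshGap_eq_zero hα hβ hγ hαβ hβγ (h₀₂ b)
    obtain ⟨e₁', e₂'⟩ := observable_apply_of_chshGap_eq_zero hα hβ hγ hαβ hβγ (h₁₂ b)
    exact triple_product_of_correlated (bellSign_prod b)
      (anticommute_add_sub (hcc 0) (hcc 1) _) (anticommute_add_sub (hcc 2) (hcc 3) _)
      (anticommute_add_sub (hcc 4) (hcc 5) _)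
      (hcom 0) (hcom 1) (hcom 2)
      e₀ e₀' e₁ e₁' e₂ e₂'
  have hu : ∑ b, β b u = u := by rw [← sum_apply, hβ.2]; rfl
  set T := tripleCommutator (a 0) (a 1) (a 2) with hT
  set S := tripleCommutator (k 0) (k 1) (k 2) with hS
  have hTS : T u = S u := by
    rw [← hu, map_sum, map_sum]
    exact Finset.sum_congr rfl fun b _ => (key b).1
  have hrev : a 2 (a 1 (a 0 u)) = -a 0 (a 1 (a 2 u)) := by
    rw [← hu]
    simp only [map_sum, ← Finset.sum_neg_distrib]
    exact Finset.sum_congr rfl fun b _ => (key b).2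
  have hstar : star T = -T :=
    star_tripleCommutator (hα 0).star_observable (hα 1).star_observable (hα 2).star_observable
  have hT0 : T u = 0 := by
    have h₁ : inner ℝ u (T (S u)) = 0 := horth
    rw [← hTS, ← ContinuousLinearMap.adjoint_inner_left, ← ContinuousLinearMap.star_eq_adjoint,
      hstar, neg_apply, inner_neg_left, neg_eq_zero] at h₁
    exact inner_self_eq_zero.1 h₁
  have h₂ : a 0 (a 1 (a 2 u)) = 0 := by
    have h₃ : a 0 (a 1 (a 2 u)) - a 2 (a 1 (a 0 u)) = 0 := hT0
    rw [hrev, sub_neg_eq_add, ← two_smul ℝ] at h₃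
    exact (smul_eq_zero.1 h₃).resolve_left two_ne_zero
  -- Observables preserve the norm, hence are injective.
  have hinv : ∀ x v, a x v = 0 → v = 0 := fun x v hv => by
    have := norm_observable_apply (hα x) v
    rw [show observable (α x) v = 0 from hv] at this
    simpa using this.symm
  exact hinv 2 _ (hinv 1 _ (hinv 0 _ h₂))

end CommutingModel

/-! ### From the network to one pure product state -/

section Network

variable {HA HB₁ HB₂ HC Λ : Type*}
  [NormedAddCommGroup HA] [InnerProductSpace ℝ HA] [CompleteSpace HA]
  [NormedAddCommGroup HB₁] [InnerProductSpace ℝ HB₁] [CompleteSpace HB₁]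
  [NormedAddCommGroup HB₂] [InnerProductSpace ℝ HB₂] [CompleteSpace HB₂]
  [NormedAddCommGroup HC] [InnerProductSpace ℝ HC] [CompleteSpace HC]

variable (HA HB₁ HB₂ HC) in
/-- The space of the three parties. -/
abbrev PartySpace : Type _ := HTensor ℝ HA (HTensor ℝ (HTensor ℝ HB₁ HB₂) HC)

variable (HA HB₁ HB₂ HC) in
/-- Alice's operators on the space of the three parties. -/
def aliceHom : (HA →L[ℝ] HA) →⋆ₐ[ℝ]
    (PartySpace HA HB₁ HB₂ HC →L[ℝ] PartySpace HA HB₁ HB₂ HC) :=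
  ampLeft ℝ HA _

variable (HA HB₁ HB₂ HC) in
/-- Bob's operators on the space of the three parties. -/
def bobHom : (HTensor ℝ HB₁ HB₂ →L[ℝ] HTensor ℝ HB₁ HB₂) →⋆ₐ[ℝ]
    (PartySpace HA HB₁ HB₂ HC →L[ℝ] PartySpace HA HB₁ HB₂ HC) :=
  (ampRight ℝ HA _).comp (ampLeft ℝ _ HC)

variable (HA HB₁ HB₂ HC) in
/-- Charlie's operators on the space of the three parties. -/
def charlieHom : (HC →L[ℝ] HC) →⋆ₐ[ℝ]
    (PartySpace HA HB₁ HB₂ HC →L[ℝ] PartySpace HA HB₁ HB₂ HC) :=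
  (ampRight ℝ HA _).comp (ampRight ℝ (HTensor ℝ HB₁ HB₂) HC)

omit [CompleteSpace HB₁] [CompleteSpace HB₂] in
theorem inner_partiesOp (A : HA →L[ℝ] HA) (B : HTensor ℝ HB₁ HB₂ →L[ℝ] HTensor ℝ HB₁ HB₂)
    (C : HC →L[ℝ] HC) (v v' : HTensor ℝ (HTensor ℝ HA HB₁) (HTensor ℝ HB₂ HC)) :
    inner ℝ v (partiesOp A B C v') = inner ℝ (regroup ℝ HA HB₁ HB₂ HC v)
      ((aliceHom HA HB₁ HB₂ HC A * (bobHom HA HB₁ HB₂ HC B * charlieHom HA HB₁ HB₂ HC C))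
        (regroup ℝ HA HB₁ HB₂ HC v')) := by
  have h : opTensor A (opTensor B C) =
      aliceHom HA HB₁ HB₂ HC A * (bobHom HA HB₁ HB₂ HC B * charlieHom HA HB₁ HB₂ HC C) := by
    rw [opTensor_eq_mul, opTensor_eq_mul B C, map_mul]
    rfl
  rw [← h, ← LinearIsometryEquiv.inner_map_map (regroup ℝ HA HB₁ HB₂ HC)]
  congr 1
  exact LinearIsometryEquiv.apply_symm_apply _ _

/-- A real inner product is symmetric, so the value equals its own negative. Real scalars are
essential here: over `ℂ` the value need only be purely imaginary. -/
theorem inner_eq_zero_of_star_eq_neg {H : Type*} [NormedAddCommGroup H] [InnerProductSpace ℝ H]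
    [CompleteSpace H] {S : H →L[ℝ] H} (hS : star S = -S) (x : H) : inner ℝ x (S x) = 0 := by
  have h := ContinuousLinearMap.adjoint_inner_left S x x
  rw [← ContinuousLinearMap.star_eq_adjoint, hS, neg_apply, inner_neg_left,
    real_inner_comm] at h
  linarith

/-- Over the reals, an antisymmetric operator of Alice has zero correlation with every operator of
Charlie in a product state of the two sources. -/
theorem inner_outer_eq_zero {S : HA →L[ℝ] HA} (hS : star S = -S) (T : HC →L[ℝ] HC)
    (ψ : HTensor ℝ HA HB₁) (χ : HTensor ℝ HB₂ HC) :
    inner ℝ (regroup ℝ HA HB₁ HB₂ HC (pureTensor ψ χ))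
      ((aliceHom HA HB₁ HB₂ HC S * charlieHom HA HB₁ HB₂ HC T)
        (regroup ℝ HA HB₁ HB₂ HC (pureTensor ψ χ))) = 0 := by
  -- With Bob's operator equal to `1`, the joint operator splits along the two sources and the
  -- expectation becomes a product.
  have h := inner_partiesOp S (1 : HTensor ℝ HB₁ HB₂ →L[ℝ] HTensor ℝ HB₁ HB₂) T
    (pureTensor ψ χ) (pureTensor ψ χ)
  rw [map_one, one_mul] at h
  rw [← h, partiesOp_outer, opTensor_pureTensor, inner_pureTensor,
    inner_eq_zero_of_star_eq_neg (by rw [← map_star, hS, map_neg]), zero_mul]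

/-- The trace is taken in the product of the two eigenbases, with the self-adjoint state moved to
the left of the inner product. This makes it a mixture of pure product expectations. -/
theorem hasSum_trace_opTensor {H K : Type*} [NormedAddCommGroup H] [InnerProductSpace ℝ H]
    [CompleteSpace H] [NormedAddCommGroup K] [InnerProductSpace ℝ K] [CompleteSpace K]
    {ρ : H →L[ℝ] H} {σ : K →L[ℝ] K} (hρ : star ρ = ρ) (hσ : star σ = σ) {ι κ : Type*}
    {e : HilbertBasis ι ℝ H} {f : HilbertBasis κ ℝ K} {μ : ι → ℝ} {ν : κ → ℝ}
    (he : ∀ i, ρ (e i) = μ i • e i) (hf : ∀ j, σ (f j) = ν j • f j)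
    {X : HTensor ℝ H K →L[ℝ] HTensor ℝ H K} {t : ℝ} (h : HasTrace (opTensor ρ σ ∘L X) t) :
    HasSum (fun ij : ι × κ => μ ij.1 * ν ij.2 *
      inner ℝ (pureTensor (𝕜 := ℝ) (e ij.1) (f ij.2)) (X (pureTensor (e ij.1) (f ij.2)))) t := by
  have hterm : ∀ ij : ι × κ, inner ℝ (hilbertBasisTensor e f ij)
      ((opTensor ρ σ ∘L X) (hilbertBasisTensor e f ij)) = μ ij.1 * ν ij.2 *
        inner ℝ (pureTensor (𝕜 := ℝ) (e ij.1) (f ij.2)) (X (pureTensor (e ij.1) (f ij.2))) := by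
    intro ij
    rw [ContinuousLinearMap.comp_apply, ← inner_opTensor_left, hρ, hσ, hilbertBasisTensor_apply,
      opTensor_pureTensor, he, hf, pureTensor_smul_left, pureTensor_smul_right, smul_smul,
      real_inner_smul_left]
  simpa only [hterm] using h.hasSum (hilbertBasisTensor e f)

omit [CompleteSpace HB₁] [CompleteSpace HB₂] in
/-- A linear functional that is nonnegative on the correlations of pure product states and that
vanishes on a correlation with a decomposition also vanishes for one pure product state, which
does not depend on the functional. -/
theorem exists_pure_product {p : Λ → ℝ}
    {σL : Λ → (HTensor ℝ HA HB₁ →L[ℝ] HTensor ℝ HA HB₁)}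
    {σR : Λ → (HTensor ℝ HB₂ HC →L[ℝ] HTensor ℝ HB₂ HC)}
    {A : Fin 3 → ℤˣ → (HA →L[ℝ] HA)}
    {B : Fin 2 × Fin 2 → (HTensor ℝ HB₁ HB₂ →L[ℝ] HTensor ℝ HB₁ HB₂)}
    {C : Fin 6 → ℤˣ → (HC →L[ℝ] HC)} {P : Correlation}
    (hp : ∀ l, 0 ≤ p l) (hp1 : HasSum p 1)
    (hL : ∀ l, IsState (σL l)) (hR : ∀ l, IsState (σR l))
    (hP : ∀ a b c x z, ∃ q : Λ → ℝ,
      (∀ l, HasTrace (opTensor (σL l) (σR l) ∘L partiesOp (A x a) (B b) (C z c)) (q l)) ∧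
      HasSum (fun l => p l * q l) (P a b c x z)) :
    ∃ (ψ : HTensor ℝ HA HB₁) (χ : HTensor ℝ HB₂ HC), ‖ψ‖ = 1 ∧ ‖χ‖ = 1 ∧
      ∀ g : Correlation →ₗ[ℝ] ℝ,
        (∀ u, 0 ≤ g (vectorCorrelation (fun x a => aliceHom HA HB₁ HB₂ HC (A x a))
          (fun b => bobHom HA HB₁ HB₂ HC (B b)) (fun z c => charlieHom HA HB₁ HB₂ HC (C z c)) u)) →
        g P = 0 →
        g (vectorCorrelation (fun x a => aliceHom HA HB₁ HB₂ HC (A x a))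
          (fun b => bobHom HA HB₁ HB₂ HC (B b)) (fun z c => charlieHom HA HB₁ HB₂ HC (C z c))
          (regroup ℝ HA HB₁ HB₂ HC (pureTensor ψ χ))) = 0 := by
  choose q hq hqP using hP
  set F := vectorCorrelation (fun x a => aliceHom HA HB₁ HB₂ HC (A x a))
    (fun b => bobHom HA HB₁ HB₂ HC (B b)) (fun z c => charlieHom HA HB₁ HB₂ HC (C z c)) with hF
  let Q : Λ → Correlation := fun l a b c x z => q a b c x z l
  have hQ : HasSum (fun l => p l • Q l) P := by
    simp only [Pi.hasSum]
    exact hqP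
  obtain ⟨l₀, hl₀⟩ : ∃ l, 0 < p l := by
    by_contra! hle
    have h₀ : p = 0 := funext fun l => le_antisymm (hle l) (hp l)
    exact zero_ne_one (hasSum_zero.unique (h₀ ▸ hp1))
  choose ι e μ he hμ i₀ hi₀ using fun l => (hL l).exists_eigenbasis
  choose κ f ν hf hν j₀ hj₀ using fun l => (hR l).exists_eigenbasis
  have hQl : ∀ l, HasSum (fun ij : ι l × κ l => (μ l ij.1 * ν l ij.2) •
      F (regroup ℝ HA HB₁ HB₂ HC (pureTensor (e l ij.1) (f l ij.2)))) (Q l) := by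
    intro l
    simp only [Pi.hasSum]
    intro a b c x z
    have := hasSum_trace_opTensor (hL l).1.isSelfAdjoint.star_eq (hR l).1.isSelfAdjoint.star_eq
      (he l) (hf l) (hq a b c x z l)
    simp only [inner_partiesOp] at this
    exact this
  -- Any product eigenvector of positive weight will do; it is fixed before `g`, so the same one
  -- serves all the CHSH gaps.
  refine ⟨e l₀ (i₀ l₀), f l₀ (j₀ l₀), (e l₀).orthonormal.1 _, (f l₀).orthonormal.1 _,
    fun g hg hgP => ?_⟩
  -- Correlations form a finite-dimensional space, so `g` is continuous and passes through the
  -- infinite sums.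
  let g' : Correlation →L[ℝ] ℝ := g.toContinuousLinearMap
  have hgl : ∀ l, HasSum (fun ij : ι l × κ l => μ l ij.1 * ν l ij.2 *
      g (F (regroup ℝ HA HB₁ HB₂ HC (pureTensor (e l ij.1) (f l ij.2))))) (g (Q l)) := fun l => by
    simpa [g'] using (hQl l).mapL g'
  have hterm : ∀ l (ij : ι l × κ l), 0 ≤ μ l ij.1 * ν l ij.2 *
      g (F (regroup ℝ HA HB₁ HB₂ HC (pureTensor (e l ij.1) (f l ij.2)))) := fun l ij =>
    mul_nonneg (mul_nonneg (hμ l _) (hν l _)) (hg _)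
  have hsum : HasSum (fun l => p l * g (Q l)) 0 := by
    simpa [g', hgP] using hQ.mapL g'
  -- Nonnegative terms with sum zero all vanish: first over `Λ`, then over the product eigenbasis at
  -- `l₀`.
  have h₁ := (hasSum_zero_iff_of_nonneg fun l =>
    mul_nonneg (hp l) ((hgl l).nonneg (hterm l))).1 hsum
  have h₂ : g (Q l₀) = 0 := (mul_eq_zero.1 (congrFun h₁ l₀)).resolve_left hl₀.ne'
  have h₃ := (hasSum_zero_iff_of_nonneg (hterm l₀)).1 (h₂ ▸ hgl l₀)
  exact (mul_eq_zero.1 (congrFun h₃ (i₀ l₀, j₀ l₀))).resolve_left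
    (mul_pos (hi₀ l₀) (hj₀ l₀)).ne'

theorem map_tripleCommutator {R S F : Type*} [Ring R] [Ring S] [FunLike F R S] [RingHomClass F R S]
    (φ : F) (x y z : R) : φ (tripleCommutator x y z) = tripleCommutator (φ x) (φ y) (φ z) := by
  simp [tripleCommutator]

theorem map_charliePauli {R S F : Type*} [Ring R] [Algebra ℝ R] [Ring S] [Algebra ℝ S]
    [FunLike F R S] [AlgHomClass F ℝ R S] (φ : F) (c : Fin 6 → R) (i : Fin 3) :
    φ (charliePauli c i) = charliePauli (fun z => φ (c z)) i := by
  fin_cases i <;> simp [charliePauli]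

end Network

end RealQuantum

end

open RealQuantum

theorem proposition1 (HA HB₁ HB₂ HC Λ : Type*)
    [NormedAddCommGroup HA] [InnerProductSpace ℝ HA] [CompleteSpace HA]
    [NormedAddCommGroup HB₁] [InnerProductSpace ℝ HB₁] [CompleteSpace HB₁]
    [NormedAddCommGroup HB₂] [InnerProductSpace ℝ HB₂] [CompleteSpace HB₂]
    [NormedAddCommGroup HC] [InnerProductSpace ℝ HC] [CompleteSpace HC] :
    ¬ RealQuantum.HasSwapDecomposition ℝ HA HB₁ HB₂ HC Λ RealQuantum.idealCorrelation := by
  rintro ⟨p, σL, σR, A, B, C, hp, hp1, hL, hR, hA, hB, hC, hP⟩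
  obtain ⟨ψ, χ, hψ, hχ, hg⟩ := exists_pure_product hp hp1 hL hR hP
  have hα := fun x => (hA x).map (aliceHom HA HB₁ HB₂ HC)
  have hβ := hB.map (bobHom HA HB₁ HB₂ HC)
  have hγ := fun z => (hC z).map (charlieHom HA HB₁ HB₂ HC)
  have hαβ : ∀ x a b, Commute (aliceHom HA HB₁ HB₂ HC (A x a)) (bobHom HA HB₁ HB₂ HC (B b)) :=
    fun x a b => commute_ampLeft_ampRight _ _
  have hαγ : ∀ x a z c,
      Commute (aliceHom HA HB₁ HB₂ HC (A x a)) (charlieHom HA HB₁ HB₂ HC (C z c)) :=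
    fun x a z c => commute_ampLeft_ampRight _ _
  have hβγ : ∀ z c b,
      Commute (bobHom HA HB₁ HB₂ HC (B b)) (charlieHom HA HB₁ HB₂ HC (C z c)) :=
    fun z c b => (commute_ampLeft_ampRight _ _).map (ampRight ℝ HA _)
  -- The gap is nonnegative in every vector state and zero for the ideal correlation, so it closes
  -- in the chosen product state.
  have hgap := fun b x x' z z' h₁ h₂ h₃ h₄ =>
    hg (chshGap b x x' z z')
      (fun u => chshGap_vectorCorrelation_nonneg hα hβ hγ hαβ hβγ u b x x' z z')
      (chshGap_idealCorrelation b h₁ h₂ h₃ h₄)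
  have h0 := eq_zero_of_chshGap_eq_zero hα hβ hγ hαβ hβγ hαγ
    (u := regroup ℝ HA HB₁ HB₂ HC (pureTensor ψ χ))
    (fun b => hgap b 0 1 0 1 (by simp [charlieBloch]) (by simp [charlieBloch])
      (by simp [charlieBloch]) (by simp [charlieBloch]))
    (fun b => hgap b 0 2 2 3 (by simp [charlieBloch]) (by simp [charlieBloch])
      (by simp [charlieBloch]) (by simp [charlieBloch]))
    (fun b => hgap b 1 2 4 5 (by simp [charlieBloch]) (by simp [charlieBloch])
      (by simp [charlieBloch]) (by simp [charlieBloch]))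
    (by
      have := inner_outer_eq_zero (HB₁ := HB₁) (HB₂ := HB₂) (star_tripleCommutator
        (hA 0).star_observable (hA 1).star_observable (hA 2).star_observable)
        (tripleCommutator (charliePauli (fun z => observable (C z)) 0)
          (charliePauli (fun z => observable (C z)) 1)
          (charliePauli (fun z => observable (C z)) 2)) ψ χ
      simpa only [map_tripleCommutator, map_charliePauli, map_observable] using this)
  have h1 : ‖regroup ℝ HA HB₁ HB₂ HC (pureTensor ψ χ)‖ = 1 := by
    rw [LinearIsometryEquiv.norm_map, norm_pureTensor, hψ, hχ, one_mul]
  rw [h0, norm_zero] at h1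
  exact zero_ne_one h1
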